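/- Let $\mu_1,\mu_2,\mu_3,\mu_4$ be probability measures on $\mathbb{R}^2$ that are absolutely continuous with respect to Lebesgue measure. Then there are two non-parallel lines in $\mathbb{R}^2$ such that the four closed pieces $C_1,C_2,C_3,C_4$ into which they cut the plane form an envy-free partition for $\mu_1,\dots,\mu_4$: there is a permutation $\pi$ of $\{1,2,3,4\}$ with \[ \mu_i(C_{\pi(i)}) \ge \mu_i(C_{\pi(i')}) \qquad\text{for all } i,i'\in\{1,2,3,4\}. \] Moreover, the partition can be found with access to only three of the four measures. That is, for every $k\in\{1,2,3,4\}$ and all absolutely continuous probability measures $\mu_i$ ($i\ne k$) on $\mathbb{R}^2$, there are two non-parallel lines, cutting the plane into closed pieces $C_1,\dots,C_4$, such that for every absolutely continuous probability measure $\mu_k$ on $\mathbb{R}^2$ the partition $(C_1,\dots,C_4)$ is envy-free for $\mu_1,\dots,\mu_4$; and for each $j$ such that $C_j$ has the largest $\mu_k$-measure among the four pieces, the permutation $\pi$ above can be chosen with $\pi(k)=j$. -/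

import Mathlib

open MeasureTheory

/-- The closed half-plane `{y : ⟨u, y⟩ ≤ a}`. For `u ≠ 0` it is bounded by the line `⟨u, y⟩ = a`,
and the other closed half-plane of that line is `{y : a ≤ ⟨u, y⟩}`. -/
def lowerHalfPlane (u : EuclideanSpace ℝ (Fin 2)) (a : ℝ) : Set (EuclideanSpace ℝ (Fin 2)) :=
  {y | inner ℝ u y ≤ a}

/-- The closed half-plane `{y : a ≤ ⟨u, y⟩}`. -/
def upperHalfPlane (u : EuclideanSpace ℝ (Fin 2)) (a : ℝ) : Set (EuclideanSpace ℝ (Fin 2)) :=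
  {y | a ≤ inner ℝ u y}

/-- `C` lists, in cyclic order around the crossing point, the four closed pieces into which the
plane is cut by two lines `⟨u, y⟩ = a` and `⟨v, y⟩ = b`. Linear independence of the normal vectors
says that these are lines (the normals are nonzero) and that they are not parallel, that is, that
the two lines really cut the plane into four pieces. -/
def IsTwoLinePartition (C : Fin 4 → Set (EuclideanSpace ℝ (Fin 2))) : Prop :=
  ∃ (u v : EuclideanSpace ℝ (Fin 2)) (a b : ℝ), LinearIndependent ℝ ![u, v] ∧
    C = ![upperHalfPlane u a ∩ upperHalfPlane v b,
          lowerHalfPlane u a ∩ upperHalfPlane v b,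
          lowerHalfPlane u a ∩ lowerHalfPlane v b,
          upperHalfPlane u a ∩ lowerHalfPlane v b]

/-- Giving the piece `C (π i)` to the observer `i`, for every `i`, leaves nobody envious. -/
def IsEnvyFreeAssignment {X : Type*} [MeasurableSpace X] {n : ℕ}
    (C : Fin n → Set X) (μ : Fin n → Measure X) (π : Equiv.Perm (Fin n)) : Prop :=
  ∀ i i' : Fin n, μ i (C (π i')) ≤ μ i (C (π i))

/-- The partition `C` is envy-free for the measures `μ 0, …, μ (n - 1)`. -/
def IsEnvyFreePartition {X : Type*} [MeasurableSpace X] {n : ℕ}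
    (C : Fin n → Set X) (μ : Fin n → Measure X) : Prop :=
  ∃ π : Equiv.Perm (Fin n), IsEnvyFreeAssignment C μ π

/-! It suffices to treat three measures and find two lines such that, whichever piece is set aside,
the three can pick distinct remaining pieces, each largest for its owner. The fourth measure then
takes any piece it likes best. Replace "largest piece" by the continuous weights `powerWeight p` and
average them over the three measures. One line has a fixed direction and offset `b`; the other has
angle `θ` in [0, π] and offset `a`. Choosing `a` as a function of `(θ, b)` nearly balances the two
sides of the rotating line, and Poincaré–Miranda in `(θ, b)` balances the remaining two bipartitions
of the pieces; parallel lines at `θ = 0` and `θ = π` supply the boundary signs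
(`exists_nearly_equal_weights`). As `p → ∞`, compactness yields a row-stochastic 3 × 4 matrix
supported on largest pieces, with all column sums below 1 (`exists_fractional_assignment`). Hall's
theorem turns it into the selection, even with one column deleted (`exists_injective_selection`). -/

/-! ### Poincaré–Miranda by lifting to the logarithm -/

lemma mem_Ioo_of_sin_pos {ψ : ℝ → ℝ} (hψ : Continuous ψ) (hs : ∀ t, 0 < Real.sin (ψ t))
    {s : ℝ} (h : ψ s ∈ Set.Ioo 0 Real.pi) (t : ℝ) : ψ t ∈ Set.Ioo 0 Real.pi := by
  constructor
  · by_contra! hc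
    obtain ⟨r, hr⟩ := mem_range_of_exists_le_of_exists_ge hψ ⟨t, hc⟩ ⟨s, h.1.le⟩
    have := hs r
    simp [hr] at this
  · by_contra! hc
    obtain ⟨r, hr⟩ := mem_range_of_exists_le_of_exists_ge hψ ⟨s, h.2.le⟩ ⟨t, hc⟩
    have := hs r
    simp [hr] at this

lemma exists_continuous_log {F : ℝ × ℝ → ℂ} (hF : Continuous F) (h0 : ∀ z, F z ≠ 0) (z₀ : ℝ × ℝ) :
    ∃ L : ℝ × ℝ → ℂ, Continuous L ∧ L z₀ = Complex.log (F z₀) ∧ ∀ z, Complex.exp (L z) = F z := by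
  obtain ⟨L, ⟨hL₀, hL⟩, -⟩ := Complex.isCoveringMapOn_exp.existsUnique_continuousMap_lifts
    (⟨F, hF⟩ : C(ℝ × ℝ, ℂ)) (a₀ := z₀) (e₀ := Complex.log (F z₀))
    (Complex.exp_log (h0 z₀)) (fun z => h0 z)
  exact ⟨L, L.continuous, hL₀, fun z => congrFun hL z⟩

/-- The Poincaré–Miranda theorem in the plane. -/
theorem exists_common_zero_of_boundary_signs {f g : ℝ × ℝ → ℝ} (hf : Continuous f)
    (hg : Continuous g) {x₀ x₁ y₀ y₁ : ℝ} (hx : x₀ ≤ x₁) (hy : y₀ ≤ y₁)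
    (hl : ∀ y ∈ Set.Icc y₀ y₁, 0 < f (x₀, y)) (hr : ∀ y ∈ Set.Icc y₀ y₁, f (x₁, y) < 0)
    (hb : ∀ x ∈ Set.Icc x₀ x₁, 0 < g (x, y₀)) (ht : ∀ x ∈ Set.Icc x₀ x₁, g (x, y₁) < 0) :
    ∃ z ∈ Set.Icc x₀ x₁ ×ˢ Set.Icc y₀ y₁, f z = 0 ∧ g z = 0 := by
  by_contra! hne
  -- Clamping to the rectangle extends `f + ig` to a nowhere zero map on the whole plane, where a
  -- continuous logarithm exists.
  let cx : ℝ → ℝ := fun x => max x₀ (min x₁ x)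
  let cy : ℝ → ℝ := fun y => max y₀ (min y₁ y)
  have hcx : ∀ x, cx x ∈ Set.Icc x₀ x₁ := fun x =>
    ⟨le_max_left _ _, max_le hx (min_le_left _ _)⟩
  have hcy : ∀ y, cy y ∈ Set.Icc y₀ y₁ := fun y =>
    ⟨le_max_left _ _, max_le hy (min_le_left _ _)⟩
  have hx0 : cx x₀ = x₀ := by simp [cx, hx]
  have hx1 : cx x₁ = x₁ := by simp [cx, hx]
  have hy0 : cy y₀ = y₀ := by simp [cy, hy]
  have hy1 : cy y₁ = y₁ := by simp [cy, hy]
  have hccx : Continuous cx := by fun_prop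
  have hccy : Continuous cy := by fun_prop
  let F : ℝ × ℝ → ℂ := fun z => ⟨f (cx z.1, cy z.2), g (cx z.1, cy z.2)⟩
  have hF : Continuous F := by
    have : F = fun z => ((f (cx z.1, cy z.2) : ℝ) : ℂ) + ((g (cx z.1, cy z.2) : ℝ) : ℂ) * Complex.I := by
      funext z
      apply Complex.ext <;> simp [F]
    rw [this]
    fun_prop
  have hF0 : ∀ z, F z ≠ 0 := fun z hz =>
    hne (cx z.1, cy z.2) ⟨hcx _, hcy _⟩ (congrArg Complex.re hz) (congrArg Complex.im hz)
  obtain ⟨L, hLc, hL₀, hL⟩ := exists_continuous_log hF hF0 (x₀, y₀)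
  have hre : ∀ z, 0 < Real.exp (L z).re := fun z => Real.exp_pos _
  have hcos : ∀ z, f (cx z.1, cy z.2) = Real.exp (L z).re * Real.cos (L z).im := fun z => by
    rw [← Complex.exp_re, hL]
  have hsin : ∀ z, g (cx z.1, cy z.2) = Real.exp (L z).re * Real.sin (L z).im := fun z => by
    rw [← Complex.exp_im, hL]
  have hleft : ∀ y, 0 < Real.cos (L (x₀, y)).im := fun y => by
    have := hl (cy y) (hcy y)
    have h2 := hcos (x₀, y)
    simp only [hx0] at h2
    rw [h2] at this
    exact pos_of_mul_pos_right this (hre _).le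
  have hright : ∀ y, Real.cos (L (x₁, y)).im < 0 := fun y => by
    have := hr (cy y) (hcy y)
    have h2 := hcos (x₁, y)
    simp only [hx1] at h2
    rw [h2] at this
    exact (pos_iff_neg_of_mul_neg this).mp (hre _)
  have hbot : ∀ x, 0 < Real.sin (L (x, y₀)).im := fun x => by
    have := hb (cx x) (hcx x)
    have h2 := hsin (x, y₀)
    simp only [hy0] at h2
    rw [h2] at this
    exact pos_of_mul_pos_right this (hre _).le
  have htop : ∀ x, Real.sin (L (x, y₁)).im < 0 := fun x => by
    have := ht (cx x) (hcx x)
    have h2 := hsin (x, y₁)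
    simp only [hy1] at h2
    rw [h2] at this
    exact (pos_iff_neg_of_mul_neg this).mp (hre _)
  have hpi := Real.pi_pos
  -- Follow the argument from the bottom left corner, where it is in (0, π/2). On each side one sign
  -- confines it to an interval of length π. Via the bottom, right and top it exceeds π at the top
  -- left corner; via the left side it stays below π/2.
  have hBL : (L (x₀, y₀)).im ∈ Set.Ioo 0 Real.pi := by
    have h1 := hbot x₀
    have h2 : (L (x₀, y₀)).im ∈ Set.Ioc (-Real.pi) Real.pi := by
      rw [hL₀, Complex.log_im]
      exact Complex.arg_mem_Ioc _
    refine ⟨?_, lt_of_le_of_ne h2.2 fun h => by simp [h] at h1⟩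
    by_contra! hc
    exact absurd (Real.sin_nonpos_of_nonpos_of_neg_pi_le hc h2.1.le) (not_le.2 h1)
  have hBL2 : (L (x₀, y₀)).im < Real.pi / 2 := by
    by_contra! hc
    exact absurd (Real.cos_nonpos_of_pi_div_two_le_of_le hc (by linarith [hBL.2]))
      (not_le.2 (hleft y₀))
  have hBR := mem_Ioo_of_sin_pos (ψ := fun x => (L (x, y₀)).im) (by fun_prop) hbot hBL x₁
  have hBR2 : Real.pi / 2 < (L (x₁, y₀)).im := by
    by_contra! hc
    exact absurd (Real.cos_nonneg_of_neg_pi_div_two_le_of_le (by linarith [hBR.1]) hc)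
      (not_le.2 (hright y₀))
  have hTR := mem_Ioo_of_sin_pos (ψ := fun y => (L (x₁, y)).im - Real.pi / 2) (by fun_prop)
    (fun y => by rw [Real.sin_sub_pi_div_two]; linarith [hright y]) (s := y₀)
    ⟨by linarith, by linarith [hBR.2]⟩ y₁
  have hTR2 : Real.pi < (L (x₁, y₁)).im := by
    by_contra! hc
    exact absurd (Real.sin_nonneg_of_nonneg_of_le_pi (by linarith [hTR.1]) hc)
      (not_le.2 (htop x₁))
  have hTL := mem_Ioo_of_sin_pos (ψ := fun x => (L (x, y₁)).im - Real.pi) (by fun_prop)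
    (fun x => by rw [Real.sin_sub_pi]; linarith [htop x]) (s := x₁)
    ⟨by linarith, by linarith [hTR.2]⟩ x₀
  have hTL2 := mem_Ioo_of_sin_pos (ψ := fun y => (L (x₀, y)).im + Real.pi / 2) (by fun_prop)
    (fun y => by rw [Real.sin_add_pi_div_two]; exact hleft y) (s := y₀)
    ⟨by linarith [hBL.1], by linarith⟩ y₁
  linarith [hTL.1, hTL2.2]

/-! ### Equalizing four weights with three parameters -/

/-- Strict monotonicity makes the zero unique, and the signs of `G` at `α x ± ε` persist for nearby
parameters, trapping their zeros. -/
lemma exists_continuous_zero_of_strictAnti {X : Type*} [TopologicalSpace X] {G : X × ℝ → ℝ}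
    (hG : Continuous G) (hanti : ∀ x, StrictAnti fun a => G (x, a)) {R : ℝ} (hR : 0 ≤ R)
    (hneg : ∀ x, G (x, R) ≤ 0) (hpos : ∀ x, 0 ≤ G (x, -R)) :
    ∃ α : X → ℝ, Continuous α ∧ ∀ x, α x ∈ Set.Icc (-R) R ∧ G (x, α x) = 0 := by
  have hex : ∀ x, ∃ a ∈ Set.Icc (-R) R, G (x, a) = 0 := fun x =>
    intermediate_value_Icc' (f := fun a => G (x, a)) (by linarith)
      (by fun_prop) ⟨hneg x, hpos x⟩
  choose α hα hα0 using hex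
  refine ⟨α, continuous_iff_continuousAt.2 fun x => ?_, fun x => ⟨hα x, hα0 x⟩⟩
  refine (nhds_basis_Ioo_pos (α x)).tendsto_right_iff.2 fun ε hε => ?_
  have h1 : 0 < G (x, α x - ε) := by
    rw [← hα0 x]; exact hanti x (by linarith)
  have h2 : G (x, α x + ε) < 0 := by
    rw [← hα0 x]; exact hanti x (by linarith)
  have e1 : ∀ᶠ y in nhds x, 0 < G (y, α x - ε) :=
    (by fun_prop : Continuous fun y => G (y, α x - ε)).continuousAt.eventually_const_lt h1
  have e2 : ∀ᶠ y in nhds x, G (y, α x + ε) < 0 :=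
    (by fun_prop : Continuous fun y => G (y, α x + ε)).continuousAt.eventually_lt_const h2
  filter_upwards [e1, e2] with y h1 h2
  rw [← hα0 y] at h1 h2
  exact ⟨(hanti y).lt_iff_gt.1 h1, (hanti y).lt_iff_gt.1 h2⟩

/-- Four nonnegative weights, depending on parameters `((θ, b), a)`, that sum to one and satisfy
suitable boundary conditions are nearly equal for some value of the parameters. -/
theorem exists_nearly_equal_weights {F : Fin 4 → (ℝ × ℝ) × ℝ → ℝ} (hF : ∀ j, Continuous (F j))
    (hsum : ∀ z, ∑ j, F j z = 1) {R : ℝ} (hR : 0 < R)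
    (hanti : ∀ x, Antitone fun a => F 0 (x, a) + F 3 (x, a))
    (hR0 : ∀ x, F 0 (x, R) + F 3 (x, R) ≤ 1 / 4)
    (hR1 : ∀ x, 3 / 4 ≤ F 0 (x, -R) + F 3 (x, -R))
    (hR2 : ∀ θ a, F 0 ((θ, R), a) + F 1 ((θ, R), a) ≤ 1 / 4)
    (hR3 : ∀ θ a, 3 / 4 ≤ F 0 ((θ, -R), a) + F 1 ((θ, -R), a))
    (hzero : ∀ b a, F 1 ((0, b), a) = 0 ∨ F 3 ((0, b), a) = 0)
    (hpi : ∀ b a, F 0 ((Real.pi, b), a) = 0 ∨ F 2 ((Real.pi, b), a) = 0) :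
    ∃ z ∈ (Set.Icc 0 Real.pi ×ˢ Set.Icc (-R) R) ×ˢ Set.Icc (-R) R, ∀ j, F j z ≤ 13 / 50 := by
  have hs : ∀ z, F 0 z + F 1 z + F 2 z + F 3 z = 1 := fun z => by
    rw [← hsum z, Fin.sum_univ_four]
  -- The weights are only weakly monotone in `a`. The tilt `a / (100 * R)` makes the dependence
  -- strict and costs an imbalance of at most 1/100.
  obtain ⟨α, hαc, hα⟩ := exists_continuous_zero_of_strictAnti
    (G := fun z : (ℝ × ℝ) × ℝ => 2 * (F 0 z + F 3 z) - 1 - z.2 / (100 * R))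
    (by have := hF 0; have := hF 3; fun_prop)
    (fun x a a' h => by
      have := hanti x h.le
      have : a / (100 * R) < a' / (100 * R) := by gcongr
      dsimp only at *; linarith)
    (R := R) hR.le
    (fun x => by
      have := hR0 x
      have : 0 < R / (100 * R) := by positivity
      dsimp only; linarith)
    (fun x => by
      have := hR1 x
      have : 0 < R / (100 * R) := by positivity
      dsimp only; rw [neg_div]; linarith)
  have hg1 : ∀ x, |2 * (F 0 (x, α x) + F 3 (x, α x)) - 1| ≤ 1 / 100 := fun x => by
    obtain ⟨h1, h2⟩ := hα x
    have : 2 * (F 0 (x, α x) + F 3 (x, α x)) - 1 = α x / (100 * R) := by dsimp only at h2; linarith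
    rw [this, abs_div, abs_of_pos (by positivity : 0 < 100 * R), div_le_div_iff₀ (by positivity) (by norm_num)]
    linarith [abs_le.2 h1]
  have hFα : ∀ j, Continuous fun x => F j (x, α x) := fun j => by
    have := hF j; fun_prop
  have c0 := hFα 0
  have c1 := hFα 1
  have c2 := hFα 2
  have c3 := hFα 3
  -- The difference of diagonal weights alone may vanish at parallel lines, e.g. for `F 2 = F 3 =
  -- 1/2`. The multiple of `|g|`, with coefficient running from 2 to -2, forces the strict boundary
  -- signs and disappears where `g = 0`.
  obtain ⟨x, hx, hx1, hx2⟩ := exists_common_zero_of_boundary_signs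
    (f := fun x => F 0 (x, α x) + F 2 (x, α x) - F 1 (x, α x) - F 3 (x, α x) +
      2 * (1 - 2 * x.1 / Real.pi) *
        |F 0 (x, α x) + F 1 (x, α x) - F 2 (x, α x) - F 3 (x, α x)|)
    (g := fun x => F 0 (x, α x) + F 1 (x, α x) - F 2 (x, α x) - F 3 (x, α x))
    (by fun_prop) (by fun_prop) Real.pi_pos.le (by linarith : -R ≤ R)
    (fun y _ => by
      have h1 := abs_le.1 (hg1 (0, y))
      have h2 := hs ((0, y), α (0, y))
      have h3 := le_abs_self (F 0 ((0, y), α (0, y)) + F 1 ((0, y), α (0, y)) -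
        F 2 ((0, y), α (0, y)) - F 3 ((0, y), α (0, y)))
      have h4 := neg_le_abs (F 0 ((0, y), α (0, y)) + F 1 ((0, y), α (0, y)) -
        F 2 ((0, y), α (0, y)) - F 3 ((0, y), α (0, y)))
      simp only [mul_zero, zero_div, sub_zero, mul_one]
      rcases hzero y (α (0, y)) with h | h <;> linarith)
    (fun y _ => by
      have h1 := abs_le.1 (hg1 (Real.pi, y))
      have h2 := hs ((Real.pi, y), α (Real.pi, y))
      have h3 := le_abs_self (F 0 ((Real.pi, y), α (Real.pi, y)) + F 1 ((Real.pi, y), α (Real.pi, y)) -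
        F 2 ((Real.pi, y), α (Real.pi, y)) - F 3 ((Real.pi, y), α (Real.pi, y)))
      have h4 := neg_le_abs (F 0 ((Real.pi, y), α (Real.pi, y)) + F 1 ((Real.pi, y), α (Real.pi, y)) -
        F 2 ((Real.pi, y), α (Real.pi, y)) - F 3 ((Real.pi, y), α (Real.pi, y)))
      have h5 : 2 * (1 - 2 * Real.pi / Real.pi) = (-2 : ℝ) := by
        field_simp; norm_num
      simp only [h5]
      rcases hpi y (α (Real.pi, y)) with h | h <;> linarith)
    (fun θ _ => by
      have h1 := hR3 θ (α (θ, -R))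
      have h2 := hs ((θ, -R), α (θ, -R))
      linarith)
    (fun θ _ => by
      have h1 := hR2 θ (α (θ, R))
      have h2 := hs ((θ, R), α (θ, R))
      linarith)
  rw [hx2] at hx1
  simp only [abs_zero, mul_zero, add_zero] at hx1
  have h1 := abs_le.1 (hg1 x)
  have h2 := hs (x, α x)
  refine ⟨(x, α x), ⟨hx, (hα x).1⟩, fun j => ?_⟩
  fin_cases j <;> simp only [Fin.zero_eta, Fin.mk_one, Fin.reduceFinMk] <;> linarith

/-! ### Power weights and their limit for large exponents -/

/-- The powers `x j ^ p`, normalized so that they sum to one. -/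
noncomputable def powerWeight (p : ℕ) (x : Fin 4 → ℝ) (j : Fin 4) : ℝ :=
  x j ^ p / ∑ k, x k ^ p

lemma sum_pow_pos {x : Fin 4 → ℝ} (hx : ∀ j, 0 ≤ x j) (hs : ∑ j, x j = 1) (p : ℕ) :
    0 < ∑ k, x k ^ p := by
  obtain ⟨j, -, hj⟩ := Finset.exists_lt_of_sum_lt (s := Finset.univ) (f := fun _ : Fin 4 => (0 : ℝ))
    (g := x) (by simp [hs])
  exact Finset.sum_pos' (fun k _ => pow_nonneg (hx k) p) ⟨j, Finset.mem_univ j, pow_pos hj p⟩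

lemma powerWeight_nonneg {x : Fin 4 → ℝ} (hx : ∀ j, 0 ≤ x j) (p : ℕ) (j : Fin 4) :
    0 ≤ powerWeight p x j :=
  div_nonneg (pow_nonneg (hx j) p) (Finset.sum_nonneg fun k _ => pow_nonneg (hx k) p)

lemma sum_powerWeight {x : Fin 4 → ℝ} (hx : ∀ j, 0 ≤ x j) (hs : ∑ j, x j = 1) (p : ℕ) :
    ∑ j, powerWeight p x j = 1 := by
  simp only [powerWeight]
  rw [← Finset.sum_div, div_self (sum_pow_pos hx hs p).ne']

lemma powerWeight_le_one {x : Fin 4 → ℝ} (hx : ∀ j, 0 ≤ x j) (hs : ∑ j, x j = 1) (p : ℕ)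
    (j : Fin 4) : powerWeight p x j ≤ 1 := by
  rw [← sum_powerWeight hx hs p]
  exact Finset.single_le_sum (fun k _ => powerWeight_nonneg hx p k) (Finset.mem_univ j)

lemma powerWeight_eq_zero {x : Fin 4 → ℝ} {p : ℕ} (hp : p ≠ 0) {j : Fin 4} (h : x j = 0) :
    powerWeight p x j = 0 := by
  simp [powerWeight, h, hp]

lemma powerWeight_le_pow {x : Fin 4 → ℝ} (hx : ∀ j, 0 ≤ x j) {r : ℝ} (hr : 0 ≤ r) {j k : Fin 4}
    (hk : 0 < x k) (h : x j ≤ r * x k) (p : ℕ) : powerWeight p x j ≤ r ^ p := by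
  have h1 : x k ^ p ≤ ∑ l, x l ^ p :=
    Finset.single_le_sum (f := fun l => x l ^ p) (fun l _ => pow_nonneg (hx l) p)
      (Finset.mem_univ k)
  have h2 : 0 < x k ^ p := pow_pos hk p
  rw [powerWeight, div_le_iff₀ (h2.trans_le h1)]
  calc x j ^ p ≤ (r * x k) ^ p := pow_le_pow_left₀ (hx j) h p
    _ = r ^ p * x k ^ p := mul_pow _ _ _
    _ ≤ _ := by gcongr

/-- The ratio s / (s + t) grows with s and falls with t. This gives the monotonicity in the offset
`a`. -/
lemma powerWeight_add_le_powerWeight_add {x y : Fin 4 → ℝ} (hx : ∀ j, 0 ≤ x j) (hxs : ∑ j, x j = 1)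
    (hy : ∀ j, 0 ≤ y j) (hys : ∑ j, y j = 1) (p : ℕ)
    (h0 : x 0 ≤ y 0) (h3 : x 3 ≤ y 3) (h1 : y 1 ≤ x 1) (h2 : y 2 ≤ x 2) :
    powerWeight p x 0 + powerWeight p x 3 ≤ powerWeight p y 0 + powerWeight p y 3 := by
  have hX := sum_pow_pos hx hxs p
  have hY := sum_pow_pos hy hys p
  simp only [powerWeight, ← add_div]
  rw [div_le_div_iff₀ hX hY, Fin.sum_univ_four, Fin.sum_univ_four]
  have e0 := pow_le_pow_left₀ (hx 0) h0 p
  have e3 := pow_le_pow_left₀ (hx 3) h3 p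
  have e1 := pow_le_pow_left₀ (hy 1) h1 p
  have e2 := pow_le_pow_left₀ (hy 2) h2 p
  have a0 := pow_nonneg (hx 0) p
  have a3 := pow_nonneg (hx 3) p
  have b1 := pow_nonneg (hy 1) p
  have b2 := pow_nonneg (hy 2) p
  have := mul_le_mul (add_le_add e0 e3) (add_le_add e1 e2) (by positivity) (by linarith)
  linarith

/-- The larger of the other two entries is at least 9/20, hence at least `3 * (x i + x j)`; its
power is then at least three times the sum of the two small powers, uniformly in `p ≥ 1`. -/
lemma powerWeight_add_le {x : Fin 4 → ℝ} (hx : ∀ j, 0 ≤ x j) (hs : ∑ j, x j = 1) {p : ℕ}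
    (hp : p ≠ 0) {i j k l : Fin 4} (hsum : ∀ f : Fin 4 → ℝ, ∑ m, f m = f i + f j + f k + f l)
    (h : x i + x j ≤ 1 / 10) : powerWeight p x i + powerWeight p x j ≤ 1 / 4 := by
  obtain ⟨n, rfl⟩ := Nat.exists_eq_succ_of_ne_zero hp
  have hX := sum_pow_pos hx hs (n + 1)
  rw [hsum] at hs
  simp only [powerWeight, ← add_div, Nat.succ_eq_add_one]
  rw [div_le_iff₀ hX, hsum]
  wlog hkl : x l ≤ x k generalizing k l
  · have := this (k := l) (l := k) (by linarith) (fun f => by rw [hsum]; ring) (by linarith)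
    linarith
  have hi := pow_le_pow_left₀ (hx i) (by linarith [hx j] : x i ≤ x k) n
  have hj := pow_le_pow_left₀ (hx j) (by linarith [hx i] : x j ≤ x k) n
  have hi' := mul_le_mul_of_nonneg_right hi (hx i)
  have hj' := mul_le_mul_of_nonneg_right hj (hx j)
  have hl := pow_nonneg (hx l) (n + 1)
  have hk := pow_nonneg (hx k) n
  have := mul_nonneg hk (by linarith : 0 ≤ x k - 3 * (x i + x j))
  simp only [pow_succ] at *
  linarith

lemma continuous_powerWeight {Z : Type*} [TopologicalSpace Z] {x : Z → Fin 4 → ℝ}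
    (hc : ∀ j, Continuous fun z => x z j) (hx : ∀ z j, 0 ≤ x z j) (hs : ∀ z, ∑ j, x z j = 1)
    (p : ℕ) (j : Fin 4) : Continuous fun z => powerWeight p (x z) j :=
  ((hc j).pow p).div (continuous_finsetSum _ fun k _ => (hc k).pow p)
    fun z => (sum_pow_pos (hx z) (hs z) p).ne'

/-- A ratio `r < 1` strictly above `y j / y k` eventually bounds `x n j / x n k`, so the weight is
at most `r ^ p n`. -/
lemma tendsto_powerWeight_zero {x : ℕ → Fin 4 → ℝ} {y : Fin 4 → ℝ} {p : ℕ → ℕ}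
    (hp : Filter.Tendsto p Filter.atTop Filter.atTop) (hx : ∀ n j, 0 ≤ x n j)
    (hxy : ∀ j, Filter.Tendsto (fun n => x n j) Filter.atTop (nhds (y j))) {j k : Fin 4}
    (h : y j < y k) :
    Filter.Tendsto (fun n => powerWeight (p n) (x n) j) Filter.atTop (nhds 0) := by
  have hj : 0 ≤ y j := ge_of_tendsto' (hxy j) fun n => hx n j
  have hk : 0 < y k := hj.trans_lt h
  obtain ⟨r, hr1, hr2⟩ := exists_between ((div_lt_one hk).2 h)
  have hr0 : 0 ≤ r := (div_nonneg hj hk.le).trans hr1.le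
  have e1 : ∀ᶠ n in Filter.atTop, 0 < x n k := (hxy k).eventually_const_lt hk
  have e2 : ∀ᶠ n in Filter.atTop, x n j < r * x n k :=
    (hxy j).eventually_lt ((hxy k).const_mul r) ((div_lt_iff₀ hk).1 hr1)
  refine squeeze_zero' (.of_forall fun n => powerWeight_nonneg (hx n) _ _) ?_
    ((tendsto_pow_atTop_nhds_zero_of_lt_one hr0 hr2).comp hp)
  filter_upwards [e1, e2] with n h1 h2
  exact powerWeight_le_pow (hx n) hr0 h1 h2.le _

/-- A compactness argument turns nearly equal averaged weights, for all exponents, into a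
fractional assignment of largest pieces. -/
theorem exists_fractional_assignment {ι Z : Type*} [Fintype ι] [TopologicalSpace Z]
    [FirstCountableTopology Z] {K : Set Z} (hK : IsCompact K) {m : ι → Z → Fin 4 → ℝ}
    (hc : ∀ i j, Continuous fun z => m i z j) (hm : ∀ i z j, 0 ≤ m i z j)
    (hs : ∀ i z, ∑ j, m i z j = 1) {c : ℝ}
    (h : ∀ p : ℕ, p ≠ 0 → ∃ z ∈ K, ∀ j, ∑ i, powerWeight p (m i z) j ≤ c) :
    ∃ z ∈ K, ∃ M : ι → Fin 4 → ℝ, (∀ i j, 0 ≤ M i j) ∧ (∀ i, ∑ j, M i j = 1) ∧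
      (∀ j, ∑ i, M i j ≤ c) ∧ ∀ i j, 0 < M i j → ∀ k, m i z k ≤ m i z j := by
  choose! z hzK hz using fun n : ℕ => h (n + 1) n.succ_ne_zero
  let M : ℕ → ι → Fin 4 → ℝ := fun n i j => powerWeight (n + 1) (m i (z n)) j
  have hcpt : IsCompact (K ×ˢ (Set.univ.pi fun _ : ι => Set.univ.pi fun _ : Fin 4 =>
      Set.Icc (0 : ℝ) 1)) :=
    hK.prod (isCompact_univ_pi fun _ => isCompact_univ_pi fun _ => isCompact_Icc)
  obtain ⟨⟨w, N⟩, ⟨hw, -⟩, φ, hφ, hlim⟩ := hcpt.tendsto_subseq (x := fun n => (z n, M n))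
    fun n => ⟨hzK n, fun i _ j _ =>
      ⟨powerWeight_nonneg (hm i _) _ _, powerWeight_le_one (hm i _) (hs i _) _ _⟩⟩
  rw [Prod.tendsto_iff] at hlim
  obtain ⟨hlz, hlM⟩ := hlim
  have hN : ∀ i j, Filter.Tendsto (fun n => M (φ n) i j) Filter.atTop (nhds (N i j)) := fun i j =>
    tendsto_pi_nhds.1 (tendsto_pi_nhds.1 hlM i) j
  refine ⟨w, hw, N, fun i j => ge_of_tendsto' (hN i j) fun n => powerWeight_nonneg (hm i _) _ _,
    fun i => ?_, fun j => ?_, fun i j hij k => ?_⟩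
  · refine tendsto_nhds_unique (tendsto_finsetSum _ fun j _ => hN i j) ?_
    refine Filter.Tendsto.congr (fun n => ?_) tendsto_const_nhds
    exact (sum_powerWeight (hm i _) (hs i _) _).symm
  · exact le_of_tendsto' (tendsto_finsetSum _ fun i _ => hN i j) fun n => hz (φ n) j
  · by_contra! hlt
    refine hij.ne' (tendsto_nhds_unique (hN i j) ?_)
    exact tendsto_powerWeight_zero (p := fun n => φ n + 1)
      ((Filter.tendsto_add_atTop_nat 1).comp hφ.tendsto_atTop) (fun n => hm i _)
      (fun j => (hc i j).continuousAt.tendsto.comp hlz) hlt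

/-! ### From a fractional to an integral assignment -/

/-- If each of the columns of a nonnegative matrix with row sums one has sum less than one, then
each row can select an entry of its support, with distinct columns and avoiding a given column. -/
theorem exists_injective_selection {ι κ : Type*} [Fintype ι] [Fintype κ] [DecidableEq κ]
    {M : ι → κ → ℝ} (h0 : ∀ i j, 0 ≤ M i j) (hs : ∀ i, ∑ j, M i j = 1)
    (hc : ∀ j, ∑ i, M i j < 1) (j₀ : κ) :
    ∃ f : ι → κ, Function.Injective f ∧ ∀ i, f i ≠ j₀ ∧ 0 < M i (f i) := by
  classical
  let t : ι → Finset κ := fun i => Finset.univ.filter fun j => j ≠ j₀ ∧ 0 < M i j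
  obtain ⟨f, hf, hft⟩ := (Finset.all_card_le_biUnion_card_iff_exists_injective t).1 fun s => by
    rcases s.eq_empty_or_nonempty with rfl | hne
    · simp
    -- The columns in `T` carry the full mass `s.card` of the rows in `s`, and each carries less
    -- than 1. So `T` has a column to spare, which pays for deleting `j₀`.
    set T := insert j₀ (s.biUnion t) with hT
    have hrow : ∀ i ∈ s, ∑ j ∈ T, M i j = 1 := fun i hi => by
      rw [← hs i]
      refine Finset.sum_subset (Finset.subset_univ _) fun j _ hj => ?_
      refine le_antisymm (not_lt.1 fun hpos => hj ?_) (h0 i j)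
      by_cases hj0 : j = j₀
      · exact hj0 ▸ Finset.mem_insert_self _ _
      · exact Finset.mem_insert_of_mem
          (Finset.mem_biUnion.2 ⟨i, hi, Finset.mem_filter.2 ⟨Finset.mem_univ _, hj0, hpos⟩⟩)
    have hlt : (s.card : ℝ) < T.card := by
      calc (s.card : ℝ) = ∑ i ∈ s, ∑ j ∈ T, M i j := by
            rw [Finset.sum_congr rfl hrow]; simp
        _ = ∑ j ∈ T, ∑ i ∈ s, M i j := Finset.sum_comm
        _ ≤ ∑ j ∈ T, ∑ i, M i j := Finset.sum_le_sum fun j _ =>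
            Finset.sum_le_univ_sum_of_nonneg fun i => h0 i j
        _ < ∑ j ∈ T, (1 : ℝ) :=
            Finset.sum_lt_sum_of_nonempty ⟨j₀, Finset.mem_insert_self _ _⟩ fun j _ => hc j
        _ = T.card := by simp
    have h1 : s.card < T.card := by exact_mod_cast hlt
    have h2 : T.card ≤ (s.biUnion t).card + 1 := Finset.card_insert_le _ _
    omega
  exact ⟨f, hf, fun i => (Finset.mem_filter.1 (hft i)).2⟩

/-! ### Measures of the pieces: continuity, additivity, degenerate positions -/

/-- The four closed pieces cut out by the lines `⟨u, y⟩ = a` and `⟨v, y⟩ = b`. -/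
def twoLinePieces (u v : EuclideanSpace ℝ (Fin 2)) (a b : ℝ) :
    Fin 4 → Set (EuclideanSpace ℝ (Fin 2)) :=
  ![upperHalfPlane u a ∩ upperHalfPlane v b,
    lowerHalfPlane u a ∩ upperHalfPlane v b,
    lowerHalfPlane u a ∩ lowerHalfPlane v b,
    upperHalfPlane u a ∩ lowerHalfPlane v b]

lemma lowerHalfPlane_eq_upperHalfPlane_neg (u : EuclideanSpace ℝ (Fin 2)) (a : ℝ) :
    lowerHalfPlane u a = upperHalfPlane (-u) (-a) := by
  ext y
  simp [lowerHalfPlane, upperHalfPlane]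

lemma measurableSet_upperHalfPlane (u : EuclideanSpace ℝ (Fin 2)) (a : ℝ) :
    MeasurableSet (upperHalfPlane u a) :=
  (isClosed_le continuous_const (by fun_prop)).measurableSet

lemma measure_line_eq_zero {μ : Measure (EuclideanSpace ℝ (Fin 2))} (hμ : μ ≪ volume)
    {u : EuclideanSpace ℝ (Fin 2)} (hu : u ≠ 0) (a : ℝ) : μ {y | inner ℝ u y = a} = 0 := by
  apply hμ
  rcases Set.eq_empty_or_nonempty {y : EuclideanSpace ℝ (Fin 2) | inner ℝ u y = a} with h | ⟨p, hp⟩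
  · rw [h, measure_empty]
  refine measure_mono_null (t := (AffineSubspace.mk' p (ℝ ∙ u)ᗮ : Set _)) (fun y hy => ?_)
    (Measure.addHaar_affineSubspace _ _ fun h => hu ?_)
  · rw [SetLike.mem_coe, AffineSubspace.mem_mk', Submodule.mem_orthogonal_singleton_iff_inner_right,
      vsub_eq_sub, inner_sub_right]
    simp only [Set.mem_ofPred_eq] at hy hp
    rw [hy, hp, sub_self]
  · have h1 : (ℝ ∙ u)ᗮ = ⊤ := by
      rw [← AffineSubspace.direction_mk' p (ℝ ∙ u)ᗮ, h, AffineSubspace.direction_top]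
    rw [Submodule.orthogonal_eq_top_iff, Submodule.span_singleton_eq_bot] at h1
    exact h1

lemma ae_inner_ne {μ : Measure (EuclideanSpace ℝ (Fin 2))} (hμ : μ ≪ volume)
    {u : EuclideanSpace ℝ (Fin 2)} (hu : u ≠ 0) (a : ℝ) : ∀ᵐ y ∂μ, inner ℝ u y ≠ a := by
  rw [ae_iff]
  simpa using measure_line_eq_zero hμ hu a

lemma eventually_mem_upperHalfPlane_iff {Z : Type*} [TopologicalSpace Z]
    {w : Z → EuclideanSpace ℝ (Fin 2)} {c : Z → ℝ} (hw : Continuous w) (hc : Continuous c) {z₀ : Z}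
    {y : EuclideanSpace ℝ (Fin 2)} (hy : inner ℝ (w z₀) y ≠ c z₀) :
    ∀ᶠ z in nhds z₀, y ∈ upperHalfPlane (w z) (c z) ↔ y ∈ upperHalfPlane (w z₀) (c z₀) := by
  have hi : Continuous fun z => inner ℝ (w z) y := by fun_prop
  rcases lt_or_gt_of_ne hy with h | h
  · filter_upwards [hi.continuousAt.eventually_lt hc.continuousAt h] with z hz
    exact iff_of_false (not_le.2 hz) (not_le.2 h)
  · filter_upwards [hc.continuousAt.eventually_lt hi.continuousAt h] with z hz
    exact iff_of_true hz.le h.le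

/-- Almost every point is off both boundary lines, and its membership is then locally constant in
the parameter; so the indicators converge almost everywhere. -/
lemma continuous_measureReal_inter_upperHalfPlane {Z : Type*} [TopologicalSpace Z]
    [FirstCountableTopology Z] {μ : Measure (EuclideanSpace ℝ (Fin 2))} [IsFiniteMeasure μ]
    (hμ : μ ≪ volume) {w₁ w₂ : Z → EuclideanSpace ℝ (Fin 2)} {c₁ c₂ : Z → ℝ}
    (hw₁ : Continuous w₁) (hw₂ : Continuous w₂) (hc₁ : Continuous c₁) (hc₂ : Continuous c₂)
    (h₁ : ∀ z, w₁ z ≠ 0) (h₂ : ∀ z, w₂ z ≠ 0) :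
    Continuous fun z => μ.real (upperHalfPlane (w₁ z) (c₁ z) ∩ upperHalfPlane (w₂ z) (c₂ z)) := by
  refine continuous_iff_continuousAt.2 fun z₀ => ?_
  refine (ENNReal.tendsto_toReal (measure_ne_top μ _)).comp ?_
  refine tendsto_measure_of_ae_tendsto_indicator_of_isFiniteMeasure (nhds z₀)
    ((measurableSet_upperHalfPlane _ _).inter (measurableSet_upperHalfPlane _ _))
    (fun z => (measurableSet_upperHalfPlane _ _).inter (measurableSet_upperHalfPlane _ _)) ?_
  filter_upwards [ae_inner_ne hμ (h₁ z₀) (c₁ z₀), ae_inner_ne hμ (h₂ z₀) (c₂ z₀)] with y hy₁ hy₂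
  filter_upwards [eventually_mem_upperHalfPlane_iff hw₁ hc₁ hy₁,
    eventually_mem_upperHalfPlane_iff hw₂ hc₂ hy₂] with z hz₁ hz₂
  exact and_congr hz₁ hz₂

lemma continuous_measureReal_twoLinePieces {Z : Type*} [TopologicalSpace Z]
    [FirstCountableTopology Z] {μ : Measure (EuclideanSpace ℝ (Fin 2))} [IsFiniteMeasure μ]
    (hμ : μ ≪ volume) {u v : Z → EuclideanSpace ℝ (Fin 2)} {a b : Z → ℝ}
    (hu : Continuous u) (hv : Continuous v) (ha : Continuous a) (hb : Continuous b)
    (hu0 : ∀ z, u z ≠ 0) (hv0 : ∀ z, v z ≠ 0) (j : Fin 4) :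
    Continuous fun z => μ.real (twoLinePieces (u z) (v z) (a z) (b z) j) := by
  fin_cases j <;> simp only [twoLinePieces, lowerHalfPlane_eq_upperHalfPlane_neg] <;>
    apply continuous_measureReal_inter_upperHalfPlane hμ <;>
    first | fun_prop | simpa using hu0 | simpa using hv0

lemma measureReal_inter_upperHalfPlane_add_lowerHalfPlane
    {μ : Measure (EuclideanSpace ℝ (Fin 2))} [IsFiniteMeasure μ] (hμ : μ ≪ volume)
    {v : EuclideanSpace ℝ (Fin 2)} (hv : v ≠ 0) (b : ℝ) (A : Set (EuclideanSpace ℝ (Fin 2))) :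
    μ.real (A ∩ upperHalfPlane v b) + μ.real (A ∩ lowerHalfPlane v b) = μ.real A := by
  rw [← measureReal_inter_add_sdiff (s := A) (measurableSet_upperHalfPlane v b)]
  congr 1
  apply measureReal_congr
  filter_upwards [ae_inner_ne hμ hv b] with y hy
  apply propext
  change (y ∈ A ∧ inner ℝ v y ≤ b) ↔ (y ∈ A ∧ ¬ b ≤ inner ℝ v y)
  rw [not_le, hy.le_iff_lt]

lemma measureReal_upperHalfPlane_add_lowerHalfPlane
    {μ : Measure (EuclideanSpace ℝ (Fin 2))} [IsProbabilityMeasure μ] (hμ : μ ≪ volume)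
    {v : EuclideanSpace ℝ (Fin 2)} (hv : v ≠ 0) (b : ℝ) :
    μ.real (upperHalfPlane v b) + μ.real (lowerHalfPlane v b) = 1 := by
  simpa using measureReal_inter_upperHalfPlane_add_lowerHalfPlane hμ hv b Set.univ

section Pieces

variable {μ : Measure (EuclideanSpace ℝ (Fin 2))} [IsProbabilityMeasure μ]
  {u v : EuclideanSpace ℝ (Fin 2)}

lemma measureReal_twoLinePieces_zero_add_three (hμ : μ ≪ volume) (hv : v ≠ 0) (a b : ℝ) :
    μ.real (twoLinePieces u v a b 0) + μ.real (twoLinePieces u v a b 3) =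
      μ.real (upperHalfPlane u a) :=
  measureReal_inter_upperHalfPlane_add_lowerHalfPlane hμ hv b _

lemma measureReal_twoLinePieces_one_add_two (hμ : μ ≪ volume) (hv : v ≠ 0) (a b : ℝ) :
    μ.real (twoLinePieces u v a b 1) + μ.real (twoLinePieces u v a b 2) =
      μ.real (lowerHalfPlane u a) :=
  measureReal_inter_upperHalfPlane_add_lowerHalfPlane hμ hv b _

lemma measureReal_twoLinePieces_zero_add_one (hμ : μ ≪ volume) (hu : u ≠ 0) (a b : ℝ) :
    μ.real (twoLinePieces u v a b 0) + μ.real (twoLinePieces u v a b 1) =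
      μ.real (upperHalfPlane v b) := by
  have h := measureReal_inter_upperHalfPlane_add_lowerHalfPlane hμ hu a (upperHalfPlane v b)
  rw [Set.inter_comm, Set.inter_comm _ (lowerHalfPlane u a)] at h
  exact h

lemma measureReal_twoLinePieces_two_add_three (hμ : μ ≪ volume) (hu : u ≠ 0) (a b : ℝ) :
    μ.real (twoLinePieces u v a b 2) + μ.real (twoLinePieces u v a b 3) =
      μ.real (lowerHalfPlane v b) := by
  have h := measureReal_inter_upperHalfPlane_add_lowerHalfPlane hμ hu a (lowerHalfPlane v b)
  rw [Set.inter_comm, Set.inter_comm _ (lowerHalfPlane u a), add_comm] at h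
  exact h

lemma sum_measureReal_twoLinePieces (hμ : μ ≪ volume) (hu : u ≠ 0) (hv : v ≠ 0) (a b : ℝ) :
    ∑ j, μ.real (twoLinePieces u v a b j) = 1 := by
  rw [Fin.sum_univ_four, ← measureReal_upperHalfPlane_add_lowerHalfPlane hμ hu a,
    ← measureReal_twoLinePieces_zero_add_three hμ hv a b,
    ← measureReal_twoLinePieces_one_add_two hμ hv a b]
  ring

end Pieces

lemma measureReal_eq_zero_of_subset_line {μ : Measure (EuclideanSpace ℝ (Fin 2))}
    (hμ : μ ≪ volume) {u : EuclideanSpace ℝ (Fin 2)} (hu : u ≠ 0) {a : ℝ}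
    {s : Set (EuclideanSpace ℝ (Fin 2))} (hs : ∀ y ∈ s, inner ℝ u y = a) : μ.real s = 0 := by
  rw [measureReal_def, measure_mono_null hs (measure_line_eq_zero hμ hu a), ENNReal.toReal_zero]

/-- For parallel lines with equal normal vectors, one of two opposite pieces is null. -/
lemma twoLinePieces_self_null {u : EuclideanSpace ℝ (Fin 2)} (hu : u ≠ 0) (a b : ℝ) :
    (∀ μ : Measure (EuclideanSpace ℝ (Fin 2)), μ ≪ volume →
      μ.real (twoLinePieces u u a b 1) = 0) ∨
    (∀ μ : Measure (EuclideanSpace ℝ (Fin 2)), μ ≪ volume →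
      μ.real (twoLinePieces u u a b 3) = 0) := by
  rcases le_total a b with h | h
  · exact .inl fun μ hμ => measureReal_eq_zero_of_subset_line hμ hu (a := a) fun y hy =>
      le_antisymm hy.1 (h.trans hy.2)
  · exact .inr fun μ hμ => measureReal_eq_zero_of_subset_line hμ hu (a := a) fun y hy =>
      le_antisymm (le_trans hy.2 h) hy.1

/-- For parallel lines with opposite normal vectors, one of two opposite pieces is null. -/
lemma twoLinePieces_neg_null {u : EuclideanSpace ℝ (Fin 2)} (hu : u ≠ 0) (a b : ℝ) :
    (∀ μ : Measure (EuclideanSpace ℝ (Fin 2)), μ ≪ volume →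
      μ.real (twoLinePieces (-u) u a b 0) = 0) ∨
    (∀ μ : Measure (EuclideanSpace ℝ (Fin 2)), μ ≪ volume →
      μ.real (twoLinePieces (-u) u a b 2) = 0) := by
  have key : ∀ {y : EuclideanSpace ℝ (Fin 2)}, inner ℝ (-u) y = - inner ℝ u y := inner_neg_left _ _
  rcases le_total (-a) b with h | h
  · refine .inl fun μ hμ => measureReal_eq_zero_of_subset_line hμ hu (a := b) fun y hy => ?_
    have h1 : a ≤ inner ℝ (-u) y := hy.1
    have h2 : b ≤ inner ℝ u y := hy.2
    rw [key] at h1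
    linarith
  · refine .inr fun μ hμ => measureReal_eq_zero_of_subset_line hμ hu (a := b) fun y hy => ?_
    have h1 : inner ℝ (-u) y ≤ a := hy.1
    have h2 : inner ℝ u y ≤ b := hy.2
    rw [key] at h1
    linarith

/-- One `R` serves all directions, since each of these half-planes misses the open ball of radius
`R`. -/
lemma exists_halfPlanes_small {ι : Type*} [Finite ι]
    (μ : ι → Measure (EuclideanSpace ℝ (Fin 2))) [∀ i, IsFiniteMeasure (μ i)] {ε : ℝ}
    (hε : 0 < ε) : ∃ R : ℝ, 0 < R ∧ ∀ i, ∀ u : EuclideanSpace ℝ (Fin 2), ‖u‖ = 1 →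
      (μ i).real (upperHalfPlane u R) ≤ ε := by
  have hlim : ∀ i, Filter.Tendsto (fun n : ℕ => (μ i).real (Metric.ball 0 (n : ℝ))ᶜ) Filter.atTop
      (nhds 0) := fun i => by
    have h := tendsto_measure_iInter_atTop (μ := μ i)
      (s := fun n : ℕ => (Metric.ball (0 : EuclideanSpace ℝ (Fin 2)) (n : ℝ))ᶜ)
      (fun n => Metric.isOpen_ball.measurableSet.compl.nullMeasurableSet)
      (fun m n hmn => Set.compl_subset_compl.2 (Metric.ball_subset_ball (by exact_mod_cast hmn)))
      ⟨0, measure_ne_top _ _⟩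
    rw [← Set.compl_iUnion, Metric.iUnion_ball_nat, Set.compl_univ, measure_empty] at h
    exact (ENNReal.tendsto_toReal ENNReal.zero_ne_top).comp h
  have hev : ∀ᶠ n : ℕ in Filter.atTop, ∀ i, (μ i).real (Metric.ball 0 (n : ℝ))ᶜ < ε :=
    Filter.eventually_all.2 fun i => (hlim i).eventually_lt_const hε
  obtain ⟨n, hn, hn1⟩ := (hev.and (Filter.eventually_ge_atTop 1)).exists
  refine ⟨n, by exact_mod_cast hn1, fun i u hu => (measureReal_mono fun y hy => ?_).trans (hn i).le⟩
  have h1 : (n : ℝ) ≤ inner ℝ u y := hy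
  have h2 := real_inner_le_norm u y
  rw [hu, one_mul] at h2
  simpa using h1.trans h2

/-! ### Two lines for three measures -/

/-- The unit vector with polar angle `θ`. -/
noncomputable def unitVector (θ : ℝ) : EuclideanSpace ℝ (Fin 2) := !₂[Real.cos θ, Real.sin θ]

lemma norm_unitVector (θ : ℝ) : ‖unitVector θ‖ = 1 := by
  simp [unitVector, EuclideanSpace.norm_eq, Fin.sum_univ_two]

lemma unitVector_ne_zero (θ : ℝ) : unitVector θ ≠ 0 := by
  rw [← norm_ne_zero_iff, norm_unitVector]; exact one_ne_zero

lemma continuous_unitVector : Continuous unitVector := by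
  unfold unitVector
  fun_prop

lemma unitVector_pi : unitVector Real.pi = -unitVector 0 := by
  ext i
  fin_cases i <;> simp [unitVector]

lemma linearIndependent_unitVector {θ : ℝ} (h0 : 0 < θ) (hpi : θ < Real.pi) :
    LinearIndependent ℝ ![unitVector θ, unitVector 0] := by
  have hs := Real.sin_pos_of_pos_of_lt_pi h0 hpi
  rw [LinearIndependent.pair_iff]
  intro s t h
  have e0 := congrArg (fun w : EuclideanSpace ℝ (Fin 2) => w 0) h
  have e1 := congrArg (fun w : EuclideanSpace ℝ (Fin 2) => w 1) h
  simp [unitVector] at e0 e1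
  have hs0 : s = 0 := by
    rcases e1 with h | h
    · exact h
    · exact absurd h hs.ne'
  subst hs0
  simpa using e0

/-- For three measures there are two lines, the second one vertical, and a nonnegative `3 × 4`
matrix supported on largest pieces with row sums one and nearly equal column sums. -/
theorem exists_twoLinePieces_fractional_assignment {ι : Type*} [Fintype ι]
    (hι : Fintype.card ι = 3) (μ : ι → Measure (EuclideanSpace ℝ (Fin 2)))
    [∀ i, IsProbabilityMeasure (μ i)] (hμ : ∀ i, μ i ≪ volume) :
    ∃ θ ∈ Set.Icc 0 Real.pi, ∃ a b : ℝ, ∃ M : ι → Fin 4 → ℝ,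
      (∀ i j, 0 ≤ M i j) ∧ (∀ i, ∑ j, M i j = 1) ∧ (∀ j, ∑ i, M i j ≤ 39 / 50) ∧
      ∀ i j, 0 < M i j → ∀ k, (μ i).real (twoLinePieces (unitVector θ) (unitVector 0) a b k) ≤
        (μ i).real (twoLinePieces (unitVector θ) (unitVector 0) a b j) := by
  have hu := unitVector_ne_zero
  -- 1/10 is the threshold in `powerWeight_add_le`.
  obtain ⟨R, hR, hsmall⟩ := exists_halfPlanes_small μ (ε := 1 / 10) (by norm_num)
  have hsmall' : ∀ i, ∀ u : EuclideanSpace ℝ (Fin 2), ‖u‖ = 1 →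
      (μ i).real (lowerHalfPlane u (-R)) ≤ 1 / 10 := fun i u hu1 => by
    rw [lowerHalfPlane_eq_upperHalfPlane_neg, neg_neg]
    exact hsmall i _ (by rwa [norm_neg])
  let m : ι → (ℝ × ℝ) × ℝ → Fin 4 → ℝ := fun i z j =>
    (μ i).real (twoLinePieces (unitVector z.1.1) (unitVector 0) z.2 z.1.2 j)
  have hc : ∀ i j, Continuous fun z => m i z j := fun i j =>
    continuous_measureReal_twoLinePieces (hμ i) (continuous_unitVector.comp (by fun_prop))
      continuous_const (by fun_prop) (by fun_prop) (fun z => hu _) (fun z => hu _) j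
  have hm : ∀ i z j, 0 ≤ m i z j := fun i z j => measureReal_nonneg
  have hs : ∀ i z, ∑ j, m i z j = 1 := fun i z =>
    sum_measureReal_twoLinePieces (hμ i) (hu _) (hu _) _ _
  have avg_le : ∀ {f g : ι → ℝ} {c : ℝ}, (∀ i, f i + g i ≤ c) →
      (∑ i, f i) / 3 + (∑ i, g i) / 3 ≤ c := fun {f g c} h => by
    have h1 := Finset.sum_le_card_nsmul Finset.univ (fun i => f i + g i) c fun i _ => h i
    rw [Finset.sum_add_distrib, Finset.card_univ, hι, nsmul_eq_mul] at h1
    push_cast at h1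
    linarith
  have avg_sum : ∀ p z, ∑ j, (∑ i, powerWeight p (m i z) j) / 3 = 1 := fun p z => by
    rw [← Finset.sum_div, Finset.sum_comm,
      Finset.sum_congr rfl fun i _ => sum_powerWeight (hm i z) (hs i z) p]
    simp [hι]
  have avg_zero : ∀ {p z j}, p ≠ 0 → (∀ i, m i z j = 0) →
      (∑ i, powerWeight p (m i z) j) / 3 = 0 := fun {p z j} hp h => by
    rw [Finset.sum_eq_zero fun i _ => powerWeight_eq_zero hp (h i), zero_div]
  -- 39/50 is three times the bound 13/50 for the averages.
  obtain ⟨⟨⟨θ, b⟩, a⟩, hz, M, h1, h2, h3, h4⟩ := exists_fractional_assignment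
    (K := (Set.Icc 0 Real.pi ×ˢ Set.Icc (-R) R) ×ˢ Set.Icc (-R) R)
    ((isCompact_Icc.prod isCompact_Icc).prod isCompact_Icc) (m := m) hc hm hs (c := 39 / 50)
    fun p hp => by
      obtain ⟨z, hz, hle⟩ := exists_nearly_equal_weights
        (F := fun j z => (∑ i, powerWeight p (m i z) j) / 3)
        (fun j => (continuous_finsetSum _ fun i _ =>
          continuous_powerWeight (hc i) (hm i) (hs i) p j).div_const 3)
        (avg_sum p) hR
        (fun x a a' haa' => by
          dsimp only
          rw [← add_div, ← add_div, ← Finset.sum_add_distrib, ← Finset.sum_add_distrib]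
          refine div_le_div_of_nonneg_right (Finset.sum_le_sum fun i _ => ?_) (by norm_num)
          refine powerWeight_add_le_powerWeight_add (hm i _) (hs i _) (hm i _) (hs i _) p ?_ ?_ ?_ ?_
          · exact measureReal_mono fun y hy => ⟨haa'.trans hy.1, hy.2⟩
          · exact measureReal_mono fun y hy => ⟨haa'.trans hy.1, hy.2⟩
          · exact measureReal_mono fun y hy => ⟨le_trans hy.1 haa', hy.2⟩
          · exact measureReal_mono fun y hy => ⟨le_trans hy.1 haa', hy.2⟩)
        (fun x => avg_le fun i => by
          refine powerWeight_add_le (hm i _) (hs i _) hp (k := 1) (l := 2)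
            (fun f => by rw [Fin.sum_univ_four]; ring) ?_
          exact (measureReal_twoLinePieces_zero_add_three (hμ i) (hu 0) _ _).trans_le
            (hsmall i _ (norm_unitVector _)))
        (fun x => by
          have h1 := avg_sum p (x, -R)
          rw [Fin.sum_univ_four] at h1
          have h2 := avg_le (f := fun i => powerWeight p (m i (x, -R)) 1)
            (g := fun i => powerWeight p (m i (x, -R)) 2) (c := 1 / 4) fun i => by
              refine powerWeight_add_le (hm i _) (hs i _) hp (k := 0) (l := 3)
                (fun f => by rw [Fin.sum_univ_four]; ring) ?_
              exact (measureReal_twoLinePieces_one_add_two (hμ i) (hu 0) _ _).trans_le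
                (hsmall' i _ (norm_unitVector _))
          linarith)
        (fun θ a => avg_le fun i => by
          refine powerWeight_add_le (hm i _) (hs i _) hp (k := 2) (l := 3)
            (fun f => by rw [Fin.sum_univ_four]) ?_
          exact (measureReal_twoLinePieces_zero_add_one (hμ i) (hu θ) _ _).trans_le
            (hsmall i _ (norm_unitVector _)))
        (fun θ a => by
          have h1 := avg_sum p ((θ, -R), a)
          rw [Fin.sum_univ_four] at h1
          have h2 := avg_le (f := fun i => powerWeight p (m i ((θ, -R), a)) 2)
            (g := fun i => powerWeight p (m i ((θ, -R), a)) 3) (c := 1 / 4) fun i => by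
              refine powerWeight_add_le (hm i _) (hs i _) hp (k := 0) (l := 1)
                (fun f => by rw [Fin.sum_univ_four]; ring) ?_
              exact (measureReal_twoLinePieces_two_add_three (hμ i) (hu θ) _ _).trans_le
                (hsmall' i _ (norm_unitVector _))
          linarith)
        -- The two normals coincide at `θ = 0` and are opposite at `θ = π`; a piece that is null for
        -- all three measures has averaged weight 0.
        (fun b a => (twoLinePieces_self_null (hu 0) a b).imp
          (fun h => avg_zero hp fun i => h _ (hμ i)) (fun h => avg_zero hp fun i => h _ (hμ i)))
        (fun b a => (twoLinePieces_neg_null (hu 0) a b).imp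
          (fun h => avg_zero hp fun i => by
            simpa only [m, unitVector_pi] using h _ (hμ i))
          (fun h => avg_zero hp fun i => by
            simpa only [m, unitVector_pi] using h _ (hμ i)))
      refine ⟨z, hz, fun j => ?_⟩
      have := hle j
      linarith
  exact ⟨θ, hz.1.1, a, b, M, h1, h2, h3, h4⟩

/-- For three measures there is a partition by two lines such that, whichever piece is removed, the
three measures can select distinct remaining pieces, each one largest for its measure. -/
theorem exists_isTwoLinePartition_selection {ι : Type*} [Fintype ι]
    (hι : Fintype.card ι = 3) (μ : ι → Measure (EuclideanSpace ℝ (Fin 2)))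
    [∀ i, IsProbabilityMeasure (μ i)] (hμ : ∀ i, μ i ≪ volume) :
    ∃ C : Fin 4 → Set (EuclideanSpace ℝ (Fin 2)), IsTwoLinePartition C ∧
      ∀ j₀, ∃ f : ι → Fin 4, Function.Injective f ∧ ∀ i, f i ≠ j₀ ∧ ∀ k, μ i (C k) ≤ μ i (C (f i)) := by
  obtain ⟨θ, hθ, a, b, M, h0, hrow, hcol, hmax⟩ :=
    exists_twoLinePieces_fractional_assignment hι μ hμ
  have hu := unitVector_ne_zero
  -- The column sums total 3 and three of them use at most 117/50, so every column is nonzero. Each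
  -- piece is thus largest for some measure, hence not null, which excludes parallel lines.
  have hpos : ∀ j, ∃ i, 0 < (μ i).real (twoLinePieces (unitVector θ) (unitVector 0) a b j) := by
    intro j
    have htot : ∑ j, ∑ i, M i j = 3 := by
      rw [Finset.sum_comm, Finset.sum_congr rfl fun i _ => hrow i]
      simp [hι]
    have hj : 0 < ∑ i, M i j := by
      rw [Fin.sum_univ_four] at htot
      have c0 := hcol 0
      have c1 := hcol 1
      have c2 := hcol 2
      have c3 := hcol 3
      fin_cases j <;> simp only [Fin.zero_eta, Fin.mk_one, Fin.reduceFinMk] <;> linarith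
    obtain ⟨i, -, hi⟩ := Finset.exists_lt_of_sum_lt (s := Finset.univ) (f := fun _ : ι => (0 : ℝ))
      (g := fun i => M i j) (by simpa using hj)
    refine ⟨i, lt_of_not_ge fun hle => ?_⟩
    have h1 := sum_measureReal_twoLinePieces (hμ i) (hu θ) (hu 0) a b
    have h2 := Finset.sum_nonpos fun k (_ : k ∈ Finset.univ) => (hmax i j hi k).trans hle
    linarith
  have hnull : ∀ j, ¬ ∀ μ : Measure (EuclideanSpace ℝ (Fin 2)), μ ≪ volume →
      μ.real (twoLinePieces (unitVector θ) (unitVector 0) a b j) = 0 := fun j h => by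
    obtain ⟨i, hi⟩ := hpos j
    exact hi.ne' (h _ (hμ i))
  have hθ0 : θ ≠ 0 := by
    rintro rfl
    exact (twoLinePieces_self_null (hu 0) a b).elim (hnull 1) (hnull 3)
  have hθpi : θ ≠ Real.pi := by
    rintro rfl
    rw [unitVector_pi] at hnull
    exact (twoLinePieces_neg_null (hu 0) a b).elim (hnull 0) (hnull 2)
  refine ⟨twoLinePieces (unitVector θ) (unitVector 0) a b,
    ⟨_, _, a, b, linearIndependent_unitVector (lt_of_le_of_ne hθ.1 hθ0.symm)
      (lt_of_le_of_ne hθ.2 hθpi), rfl⟩, fun j₀ => ?_⟩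
  obtain ⟨f, hf, hf'⟩ := exists_injective_selection h0 hrow
    (fun j => (hcol j).trans_lt (by norm_num)) j₀
  refine ⟨f, hf, fun i => ⟨(hf' i).1, fun k => ?_⟩⟩
  exact (ENNReal.toReal_le_toReal (measure_ne_top _ _) (measure_ne_top _ _)).1
    (hmax i (f i) (hf' i).2 k)

/-! ### Serving the withheld measure -/

lemma exists_perm_extending {n : ℕ} {k : Fin n} {f : {i : Fin n // i ≠ k} → Fin n}
    (hf : Function.Injective f) {j : Fin n} (hj : ∀ i, f i ≠ j) :
    ∃ π : Equiv.Perm (Fin n), π k = j ∧ ∀ i, π i.1 = f i := by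
  classical
  let g : Fin n → Fin n := fun i => if h : i = k then j else f ⟨i, h⟩
  have hg : Function.Injective g := fun i i' h => by
    by_cases hi : i = k <;> by_cases hi' : i' = k
    · rw [hi, hi']
    · simp only [g, hi, hi', dite_true, dite_false] at h
      exact absurd h.symm (hj _)
    · simp only [g, hi, hi', dite_true, dite_false] at h
      exact absurd h (hj _)
    · simp only [g, hi, hi', dite_false] at h
      exact congrArg Subtype.val (hf h)
  refine ⟨Equiv.ofBijective g (Finite.injective_iff_bijective.1 hg), ?_, fun i => ?_⟩
  · simp [g]
  · simp [g, i.2]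

/-- The partition is chosen from all measures but the one with index `k`. -/
theorem exists_partition_withholding_one (k : Fin 4)
    (μ : {i : Fin 4 // i ≠ k} → Measure (EuclideanSpace ℝ (Fin 2)))
    (hp : ∀ i, IsProbabilityMeasure (μ i)) (hμ : ∀ i, μ i ≪ volume) :
    ∃ C : Fin 4 → Set (EuclideanSpace ℝ (Fin 2)), IsTwoLinePartition C ∧
      ∀ ν : Fin 4 → Measure (EuclideanSpace ℝ (Fin 2)), (∀ i : {i : Fin 4 // i ≠ k}, ν i = μ i) →
        IsEnvyFreePartition C ν ∧ ∀ j : Fin 4, (∀ j' : Fin 4, ν k (C j') ≤ ν k (C j)) →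
          ∃ π : Equiv.Perm (Fin 4), π k = j ∧ IsEnvyFreeAssignment C ν π := by
  obtain ⟨C, hC, hsel⟩ := exists_isTwoLinePartition_selection (by simp) μ hμ
  refine ⟨C, hC, fun ν hν => ?_⟩
  have key : ∀ j : Fin 4, (∀ j' : Fin 4, ν k (C j') ≤ ν k (C j)) →
      ∃ π : Equiv.Perm (Fin 4), π k = j ∧ IsEnvyFreeAssignment C ν π := fun j hj => by
    -- The withheld measure receives its favourite `j`; the others select among the remaining
    -- pieces.
    obtain ⟨f, hf, hf'⟩ := hsel j
    obtain ⟨π, hπk, hπ⟩ := exists_perm_extending hf fun i => (hf' i).1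
    refine ⟨π, hπk, fun i i' => ?_⟩
    by_cases hi : i = k
    · rw [hi, hπk]
      exact hj _
    · rw [hπ ⟨i, hi⟩, hν ⟨i, hi⟩]
      exact (hf' ⟨i, hi⟩).2 _
  obtain ⟨j, hj⟩ := Finite.exists_max fun j => ν k (C j)
  obtain ⟨π, -, hπ⟩ := key j hj
  exact ⟨⟨π, hπ⟩, key⟩

/-- First part: four measures, all known. Second part: the measure with index `k` is withheld, the
partition is chosen from the other three only, and it works whatever the withheld measure is;
moreover every piece that is largest for the withheld measure can be the one assigned to it. -/
theorem mainTheorem7 :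
    (∀ μ : Fin 4 → Measure (EuclideanSpace ℝ (Fin 2)),
      (∀ i, IsProbabilityMeasure (μ i)) → (∀ i, μ i ≪ volume) →
      ∃ C : Fin 4 → Set (EuclideanSpace ℝ (Fin 2)),
        IsTwoLinePartition C ∧ IsEnvyFreePartition C μ) ∧
    (∀ (k : Fin 4) (μ : {i : Fin 4 // i ≠ k} → Measure (EuclideanSpace ℝ (Fin 2))),
      (∀ i, IsProbabilityMeasure (μ i)) → (∀ i, μ i ≪ volume) →
      ∃ C : Fin 4 → Set (EuclideanSpace ℝ (Fin 2)),
        IsTwoLinePartition C ∧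
        ∀ ν : Fin 4 → Measure (EuclideanSpace ℝ (Fin 2)),
          (∀ i, IsProbabilityMeasure (ν i)) → (∀ i, ν i ≪ volume) →
          (∀ i : {i : Fin 4 // i ≠ k}, ν i = μ i) →
          IsEnvyFreePartition C ν ∧
          ∀ j : Fin 4, (∀ j' : Fin 4, ν k (C j') ≤ ν k (C j)) →
            ∃ π : Equiv.Perm (Fin 4), π k = j ∧ IsEnvyFreeAssignment C ν π) := by
  refine ⟨fun μ hp hμ => ?_, fun k μ hp hμ => ?_⟩
  · obtain ⟨C, hC, h⟩ := exists_partition_withholding_one 0 (fun i => μ i) (fun i => hp i)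
      fun i => hμ i
    exact ⟨C, hC, (h μ fun _ => rfl).1⟩
  · obtain ⟨C, hC, h⟩ := exists_partition_withholding_one k μ hp hμ
    exact ⟨C, hC, fun ν _ _ hν => h ν hν⟩
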